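/- Let $n\ge 0$. Write a permutation $\pi\in\mathfrak S_{m}$ as the word $(\pi(1),\dots,\pi(m))$. Its inversion set is either, by positions, $$\mathrm{inv}(\pi)=\{(i,j)\mid 1\le i<j\le m,\ \pi(i)>\pi(j)\},$$ or, by values, $$\mathrm{inv}(\pi)=\{(a,b)\mid 1\le a<b\le m,\ b\text{ stands before }a\text{ in the word of }\pi\}.$$ With either convention, the weak Bruhat order on $\mathfrak S_m$ is defined by $\pi\le\sigma$ if and only if $\mathrm{inv}(\pi)\subseteq\mathrm{inv}(\sigma)$. Let $\mathfrak P_n$ be the set of partial permutations of $[n]$, that is, of sequences $(a_1,\dots,a_r)$, $0\le r\le n$, of distinct elements of $[n]$. Let $\varphi_n:\mathfrak P_n\to\mathfrak S_{n+1}$ be the injection that appends to such a sequence the elements of $[n+1]\setminus\{a_1,\dots,a_r\}$ in descending order. The partial weak Bruhat order on $\mathfrak P_n$ is defined by $\pi\le\sigma$ if and only if $\varphi_n(\pi)\le\varphi_n(\sigma)$ in the weak Bruhat order on $\mathfrak S_{n+1}$. Theorem. For each of the two conventions, the partial weak Bruhat order on $\mathfrak P_n$ is a lattice, and it is a join-semilattice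 quotient of the weak Bruhat order on $\mathfrak S_{n+1}$ (taken with the same convention): any two elements of $\mathfrak S_{n+1}$ have a join, and there is a surjective map $f:\mathfrak S_{n+1}\to\mathfrak P_n$ with $f(u\vee v)=f(u)\vee f(v)$ for all $u,v\in\mathfrak S_{n+1}$. -/

import Mathlib

namespace PartialWeak

/-- The two usual ways to record the inversions of a permutation `π`, written as a word
`π 0, π 1, …`: a pair of entries standing in the wrong order is recorded either by the two
positions, or by the two values. -/
inductive InversionKind where
  | positions
  | values

/-- The inversion set of a permutation.
* By positions: the pairs `(i, j)` with `i < j` and `π i > π j`.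
* By values: the pairs `(a, b)` with `a < b` such that `b` stands before `a` in the word of `π`. -/
def inv {m : ℕ} : InversionKind → Equiv.Perm (Fin m) → Set (Fin m × Fin m)
  | .positions, π => {p | p.1 < p.2 ∧ π p.2 < π p.1}
  | .values, π => {p | p.1 < p.2 ∧ π.symm p.2 < π.symm p.1}

theorem eq_of_inversions_eq {m : ℕ} {π σ : Equiv.Perm (Fin m)}
    (h : {p : Fin m × Fin m | p.1 < p.2 ∧ π p.2 < π p.1} =
      {p : Fin m × Fin m | p.1 < p.2 ∧ σ p.2 < σ p.1}) : π = σ := by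
  have key : ∀ i j, i < j → (π j < π i ↔ σ j < σ i) := by
    intro i j hij
    have := Set.ext_iff.1 h (i, j)
    simpa [hij] using this
  have key2 : ∀ i j, π i < π j → σ i < σ j := by
    intro i j hij
    rcases lt_trichotomy i j with hlt | rfl | hgt
    · have h1 : ¬ σ j < σ i := fun hc => absurd ((key i j hlt).2 hc) (not_lt.2 hij.le)
      exact lt_of_le_of_ne (not_lt.1 h1) (fun he => hlt.ne (σ.injective he))
    · exact absurd hij (lt_irrefl _)
    · exact (key j i hgt).1 hij
  have mono : StrictMono (π.symm.trans σ) := by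
    intro a b hab
    exact key2 _ _ (by simpa using hab)
  have hid : (mono.orderIsoOfSurjective _ (π.symm.trans σ).surjective) = OrderIso.refl (Fin m) :=
    Subsingleton.elim _ _
  ext i
  have h3 : (π.symm.trans σ) (π i) = π i := congrArg (fun e : Fin m ≃o Fin m => e (π i)) hid
  have h4 : σ i = π i := by simpa using h3
  rw [h4]

theorem inv_injective {m : ℕ} (c : InversionKind) :
    Function.Injective (inv c : Equiv.Perm (Fin m) → Set (Fin m × Fin m)) := by
  intro π σ h
  cases c with
  | positions => exact eq_of_inversions_eq h
  | values =>
    have := eq_of_inversions_eq (π := π.symm) (σ := σ.symm) h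
    simpa using congrArg Equiv.symm this

/-- The symmetric group on `m` letters, as the carrier of the weak Bruhat order. -/
def WeakPerm (_c : InversionKind) (m : ℕ) : Type := Equiv.Perm (Fin m)

/-- The weak Bruhat order: containment of inversion sets. -/
instance (c : InversionKind) (m : ℕ) : PartialOrder (WeakPerm c m) :=
  PartialOrder.lift (fun π : Equiv.Perm (Fin m) => inv c π) (inv_injective c)

/-- Partial permutations of an `n`-element chain: sequences `(a₁, …, a_r)` of distinct entries. -/
def PartialPerm (n : ℕ) : Type := {l : List (Fin n) // l.Nodup}

/-- The word of a partial permutation on the first `n` letters, followed by all the remaining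
ones among `n + 1` letters (so at least the largest letter `Fin.last n`) in descending order. -/
def extWord {n : ℕ} (w : PartialPerm n) : List (Fin (n + 1)) :=
  w.1.map Fin.castSucc ++
    (List.finRange (n + 1)).reverse.filter (fun a => a ∉ w.1.map Fin.castSucc)

theorem extWord_nodup {n : ℕ} (w : PartialPerm n) : (extWord w).Nodup := by
  unfold extWord
  refine List.Nodup.append (w.2.map (Fin.castSucc_injective n))
    ((List.nodup_reverse.2 (List.nodup_finRange _)).filter _) ?_
  intro a ha hb
  have := (List.mem_filter.1 hb).2
  exact (of_decide_eq_true this) ha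

theorem mem_extWord {n : ℕ} (w : PartialPerm n) (a : Fin (n + 1)) : a ∈ extWord w := by
  unfold extWord
  by_cases h : a ∈ w.1.map Fin.castSucc
  · exact List.mem_append_left _ h
  · exact List.mem_append_right _ (List.mem_filter.2 ⟨by simp, decide_eq_true h⟩)

theorem extWord_length {n : ℕ} (w : PartialPerm n) : (extWord w).length = n + 1 := by
  have := Fintype.card_congr
    ((extWord_nodup w).getEquivOfForallMemList (extWord w) (mem_extWord w))
  simpa using this

/-- The map `φ_n` from partial permutations to permutations of `n + 1` letters:
`φ_n(w)` sends a position `i` to the `i`-th entry of the extended word of `w`. -/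
def phi {n : ℕ} (w : PartialPerm n) : Equiv.Perm (Fin (n + 1)) :=
  (finCongr (extWord_length w).symm).trans
    ((extWord_nodup w).getEquivOfForallMemList (extWord w) (mem_extWord w))

theorem ofFn_phi {n : ℕ} (w : PartialPerm n) : List.ofFn (phi w) = extWord w := by
  apply List.ext_getElem
  · simp [extWord_length]
  · intro i h1 h2
    simp only [List.getElem_ofFn, phi]
    rfl

theorem phi_injective (n : ℕ) : Function.Injective (phi (n := n)) := by
  -- The word of `w` is the part of the extended word before the letter `Fin.last n`.
  have key : ∀ w : PartialPerm n,
      (extWord w).takeWhile (fun a => a ≠ Fin.last n) = w.1.map Fin.castSucc := by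
    intro w
    have hl : Fin.last n ∉ w.1.map Fin.castSucc := by
      simp [Fin.castSucc_ne_last]
    unfold extWord
    rw [List.takeWhile_append_of_pos, List.finRange_succ_last, List.reverse_append]
    · simp [Fin.castSucc_ne_last]
    · intro a ha
      exact decide_eq_true (fun h => hl (h ▸ ha))
  intro v w h
  have h1 : extWord v = extWord w := by rw [← ofFn_phi, ← ofFn_phi, h]
  apply Subtype.ext
  apply List.map_injective_iff.2 (Fin.castSucc_injective n)
  rw [← key v, ← key w, h1]

/-- Partial permutations, as the carrier of the partial weak Bruhat order. -/
def WeakPartialPerm (_c : InversionKind) (n : ℕ) : Type := PartialPerm n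

/-- The partial weak Bruhat order: `π ≤ σ` if and only if `φ_n(π) ≤ φ_n(σ)` in the weak Bruhat
order on permutations of `n + 1` letters. -/
instance (c : InversionKind) (n : ℕ) : PartialOrder (WeakPartialPerm c n) :=
  PartialOrder.lift (β := WeakPerm c (n + 1)) (fun w : PartialPerm n => phi w) (phi_injective n)

end PartialWeak

/-! Passing to noninversions reverses the weak order, so a meet of two permutations should have the
smallest admissible noninversion set containing both of theirs. That set is the transitive closure
of their union: it is still cotransitive (`JoinNoninv.cotrans`), hence comes from a permutation. The
image of `phi` consists of the permutations that descend after the largest letter. It contains the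
reversed word, which is the top, and is closed under meets (`DescendingAfterLast.of_joinNoninv`). By
finiteness each `u` thus has a least `f u` with `u ≤ phi (f u)`. This `f` is left adjoint to the
order embedding `phi`, so it preserves joins and is a retraction onto the partial permutations. -/

namespace PartialWeak

/-! ### Closure maps on finite meet-semilattices -/

section Order

/-- A nonempty finite set that is directed downwards has a least element. -/
theorem exists_isLeast_of_finite {α : Type*} [PartialOrder α] [Finite α] {S : Set α}
    (hne : S.Nonempty) (hdir : ∀ x ∈ S, ∀ y ∈ S, ∃ z ∈ S, z ≤ x ∧ z ≤ y) :
    ∃ a, IsLeast S a := by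
  obtain ⟨a, ha⟩ := S.toFinite.exists_minimal hne
  refine ⟨a, ha.1, fun y hy => ?_⟩
  obtain ⟨z, hz, hza, hzy⟩ := hdir a ha.1 y hy
  exact (ha.2 hz hza).trans hzy

/-- A subposet of a finite meet-semilattice with top that contains the top and is closed under
binary meets is a lattice and a join-semilattice quotient. -/
theorem join_quotient_of_inf_closed {α β : Type*} [PartialOrder α] [PartialOrder β] [Finite α]
    [Finite β] (e : β ↪o α) (hα : ∀ u v : α, ∃ w, IsGLB {u, v} w) (t : β) (ht : IsTop (e t))
    (hβ : ∀ (x y : β) (w : α), IsGLB {e x, e y} w → ∃ z, e z = w) :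
    (∀ x y : β, (∃ z, IsLUB {x, y} z) ∧ ∃ z, IsGLB {x, y} z) ∧
      ∃ f : α → β, Function.Surjective f ∧
        ∀ u v : α, ∃ w, IsLUB {u, v} w ∧ IsLUB {f u, f v} (f w) := by
  have glb : ∀ x y : β, ∃ z, IsGLB {e x, e y} (e z) := fun x y => by
    obtain ⟨w, hw⟩ := hα (e x) (e y)
    obtain ⟨z, rfl⟩ := hβ x y w hw
    exact ⟨z, hw⟩
  have glbβ : ∀ x y : β, ∃ z, IsGLB {x, y} z := fun x y => by
    obtain ⟨z, hz⟩ := glb x y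
    refine ⟨z, IsGLB.of_image (f := e) (fun {a b} => e.le_iff_le) ?_⟩
    rwa [Set.image_pair]
  have lub : ∀ u v : α, ∃ w, IsLUB {u, v} w := fun u v => by
    refine exists_isLeast_of_finite ⟨e t, fun y _ => ht y⟩ fun x hx y hy => ?_
    obtain ⟨w, hw⟩ := hα x y
    refine ⟨w, fun a ha => hw.2 ?_, hw.1 (by simp), hw.1 (by simp)⟩
    rintro _ (rfl | rfl)
    exacts [hx ha, hy ha]
  have cl : ∀ u : α, ∃ z, IsLeast {z | u ≤ e z} z := fun u => by
    refine exists_isLeast_of_finite ⟨t, ht u⟩ fun x hx y hy => ?_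
    obtain ⟨z, hz⟩ := glb x y
    refine ⟨z, hz.2 ?_, e.le_iff_le.1 (hz.1 (by simp)), e.le_iff_le.1 (hz.1 (by simp))⟩
    rintro _ (rfl | rfl)
    exacts [hx, hy]
  choose f hf using cl
  have gc : GaloisConnection f e := fun u z =>
    ⟨fun h => (hf u).1.trans (e.le_iff_le.2 h), fun h => (hf u).2 h⟩
  have hfe : ∀ z, f (e z) = z := fun z =>
    le_antisymm (gc.l_u_le z) (e.le_iff_le.1 (gc.le_u_l (e z)))
  have hlub : ∀ u v : α, ∃ w, IsLUB {u, v} w ∧ IsLUB {f u, f v} (f w) := fun u v => by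
    obtain ⟨w, hw⟩ := lub u v
    refine ⟨w, hw, ?_⟩
    have := gc.isLUB_l_image hw
    rwa [Set.image_pair] at this
  refine ⟨fun x y => ⟨?_, glbβ x y⟩, f, fun z => ⟨e z, hfe z⟩, hlub⟩
  obtain ⟨w, -, hw⟩ := hlub (e x) (e y)
  rw [hfe, hfe] at hw
  exact ⟨_, hw⟩

end Order

/-! ### Permutations with prescribed noninversions -/

section Realization

variable {m : ℕ}

/-- A strict total order on `Fin m` is induced by a permutation. -/
theorem exists_perm_of_strictTotal (s : Fin m → Fin m → Prop) (irr : ∀ i, ¬ s i i)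
    (tr : ∀ i j k, s i j → s j k → s i k) (tot : ∀ i j, i ≠ j → s i j ∨ s j i) :
    ∃ π : Equiv.Perm (Fin m), ∀ i j, π i < π j ↔ s i j := by
  classical
  -- The permutation sends `i` to its rank, the number of elements below it.
  let r : Fin m → ℕ := fun i => (Finset.univ.filter fun k => s k i).card
  have rlt : ∀ i, r i < m := fun i => by
    have : r i < (Finset.univ : Finset (Fin m)).card :=
      Finset.card_lt_card (Finset.filter_ssubset.2 ⟨i, Finset.mem_univ _, irr i⟩)
    simpa using this
  have rmono : ∀ i j, s i j → r i < r j := fun i j h => by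
    refine Finset.card_lt_card ⟨fun k hk => ?_, fun hsub => ?_⟩
    · simp only [Finset.mem_filter, Finset.mem_univ, true_and] at hk ⊢
      exact tr _ _ _ hk h
    · have := hsub (by simpa using h : i ∈ Finset.univ.filter fun k => s k j)
      exact irr i (by simpa using this)
  let g : Fin m → Fin m := fun i => ⟨r i, rlt i⟩
  have gmono : ∀ i j, s i j → g i < g j := rmono
  have ginj : Function.Injective g := fun i j h => by
    by_contra hne
    rcases tot i j hne with hs | hs
    · exact (gmono _ _ hs).ne h
    · exact (gmono _ _ hs).ne' h
  refine ⟨Equiv.ofBijective g (Finite.injective_iff_bijective.1 ginj), fun i j => ⟨fun h => ?_,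
    gmono i j⟩⟩
  change g i < g j at h
  rcases tot i j (fun hij => by simp [hij] at h) with hs | hs
  · exact hs
  · exact absurd h (gmono _ _ hs).asymm

/-- A transitive and cotransitive subrelation of `<` is the set of noninversions of a
permutation. -/
theorem exists_perm_of_cotransitive (N : Fin m → Fin m → Prop)
    (tr : ∀ i j k, N i j → N j k → N i k)
    (cotr : ∀ i j k, i < j → j < k → N i k → N i j ∨ N j k) :
    ∃ π : Equiv.Perm (Fin m), ∀ i j, i < j → (π i < π j ↔ N i j) := by
  obtain ⟨π, hπ⟩ := exists_perm_of_strictTotal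
    -- The natural order is kept on the pairs in `N` and reversed on all others.
    (fun i j => (i < j ∧ N i j) ∨ (j < i ∧ ¬ N j i)) (by simp) (by
      rintro i j k (⟨hij, h1⟩ | ⟨hij, h1⟩) (⟨hjk, h2⟩ | ⟨hjk, h2⟩)
      · exact Or.inl ⟨hij.trans hjk, tr _ _ _ h1 h2⟩
      · rcases lt_trichotomy i k with h | rfl | h
        · exact Or.inl ⟨h, (cotr i k j h hjk h1).resolve_right h2⟩
        · exact absurd h1 h2
        · exact Or.inr ⟨h, fun h3 => h2 (tr _ _ _ h3 h1)⟩
      · rcases lt_trichotomy i k with h | rfl | h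
        · exact Or.inl ⟨h, (cotr j i k hij h h2).resolve_left h1⟩
        · exact absurd h2 h1
        · exact Or.inr ⟨h, fun h3 => h1 (tr _ _ _ h2 h3)⟩
      · exact Or.inr ⟨hjk.trans hij, fun h3 => (cotr k j i hjk hij h3).elim h2 h1⟩) (by
      intro i j hij
      rcases lt_or_gt_of_ne hij with h | h <;> by_cases h1 : N i j <;> by_cases h2 : N j i <;>
        simp [h, h1, h2])
  exact ⟨π, fun i j hij => by simp [hπ, hij, hij.asymm]⟩

/-- The relation generated by the noninversions of either of two permutations. -/
def JoinNoninv (π σ : Equiv.Perm (Fin m)) : Fin m → Fin m → Prop :=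
  Relation.TransGen fun i j => i < j ∧ (π i < π j ∨ σ i < σ j)

theorem JoinNoninv.lt {π σ : Equiv.Perm (Fin m)} {i j : Fin m} (h : JoinNoninv π σ i j) :
    i < j := by
  induction h with
  | single h => exact h.1
  | tail _ h ih => exact ih.trans h.1

/-- A chain from `i` to `k` either visits `j` or jumps over it in one step `a < j < b`. In the
permutation giving that step, the value at `j` is above the value at `a` or below the value at `b`,
so the step can be split on one side. -/
theorem JoinNoninv.cotrans {π σ : Equiv.Perm (Fin m)} {i j k : Fin m} (hij : i < j) (hjk : j < k)
    (h : JoinNoninv π σ i k) : JoinNoninv π σ i j ∨ JoinNoninv π σ j k := by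
  have step : ∀ a b, a < j → j < b → (π a < π b ∨ σ a < σ b) →
      JoinNoninv π σ a j ∨ JoinNoninv π σ j b := by
    rintro a b haj hjb (h | h)
    · rcases lt_or_ge (π a) (π j) with h1 | h1
      · exact Or.inl (.single ⟨haj, Or.inl h1⟩)
      · exact Or.inr (.single ⟨hjb, Or.inl (h1.trans_lt h)⟩)
    · rcases lt_or_ge (σ a) (σ j) with h1 | h1
      · exact Or.inl (.single ⟨haj, Or.inr h1⟩)
      · exact Or.inr (.single ⟨hjb, Or.inr (h1.trans_lt h)⟩)
  induction h with
  | single h => exact step _ _ hij hjk h.2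
  | @tail b c hb h ih =>
    rcases lt_trichotomy j b with hjb | rfl | hjb
    · exact (ih hjb).imp_right fun h' => h'.tail h
    · exact Or.inl hb
    · exact (step b c hjb hjk h.2).imp_left fun h' => Relation.TransGen.trans hb h'

/-- There is a permutation whose noninversions are generated by those of two given ones. -/
theorem exists_perm_joinNoninv (π σ : Equiv.Perm (Fin m)) :
    ∃ μ : Equiv.Perm (Fin m), ∀ i j, i < j → (μ i < μ j ↔ JoinNoninv π σ i j) :=
  exists_perm_of_cotransitive _ (fun _ _ _ h h' => Relation.TransGen.trans h h')
    fun _ _ _ h h' => JoinNoninv.cotrans h h'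

end Realization

/-! ### Meets in the weak order under both conventions -/

section Weak

variable {m n : ℕ}

/-- The permutation whose inversions by positions are the inversions of `π` for the
convention `c`. -/
def indexing (c : InversionKind) (π : Equiv.Perm (Fin m)) : Equiv.Perm (Fin m) :=
  match c with
  | .positions => π
  | .values => π.symm

theorem indexing_indexing (c : InversionKind) (π : Equiv.Perm (Fin m)) :
    indexing c (indexing c π) = π := by
  cases c <;> rfl

theorem weakPerm_le_iff {c : InversionKind} {π σ : WeakPerm c m} :
    π ≤ σ ↔ ∀ i j : Fin m, i < j → indexing c σ i < indexing c σ j →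
      indexing c π i < indexing c π j := by
  have key : π ≤ σ ↔ ∀ i j : Fin m, i < j → indexing c π j < indexing c π i →
      indexing c σ j < indexing c σ i := by
    change inv c π ⊆ inv c σ ↔ _
    cases c <;>
      exact ⟨fun h i j hij h1 => (h (show (i, j) ∈ _ from ⟨hij, h1⟩)).2,
        fun h p hp => ⟨hp.1, h _ _ hp.1 hp.2⟩⟩
  rw [key]
  refine forall₃_congr fun i j hij => ?_
  have h1 : indexing c π i ≠ indexing c π j := fun h => hij.ne ((indexing c π).injective h)
  have h2 : indexing c σ i ≠ indexing c σ j := fun h => hij.ne ((indexing c σ).injective h)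
  constructor
  · intro h h3
    exact lt_of_not_ge fun h4 => h3.asymm (h (lt_of_le_of_ne h4 h1.symm))
  · intro h h3
    exact lt_of_not_ge fun h4 => h3.asymm (h (lt_of_le_of_ne h4 h2))

/-- A permutation whose noninversions are generated by those of `π` and `σ` is their meet. -/
theorem isGLB_of_joinNoninv {c : InversionKind} {π σ μ : WeakPerm c m}
    (h : ∀ i j : Fin m, i < j →
      (indexing c μ i < indexing c μ j ↔ JoinNoninv (indexing c π) (indexing c σ) i j)) :
    IsGLB {π, σ} μ := by
  constructor
  · rintro _ (rfl | rfl) <;> refine weakPerm_le_iff.2 fun i j hij h1 => (h i j hij).2 (.single ?_)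
    exacts [⟨hij, Or.inl h1⟩, ⟨hij, Or.inr h1⟩]
  · intro ν hν
    have hπ := weakPerm_le_iff.1 (hν (show π ∈ ({π, σ} : Set _) by simp))
    have hσ := weakPerm_le_iff.1 (hν (show σ ∈ ({π, σ} : Set _) by simp))
    have step : ∀ i j : Fin m, i < j ∧ (indexing c π i < indexing c π j ∨
        indexing c σ i < indexing c σ j) → indexing c ν i < indexing c ν j :=
      fun i j hs => hs.2.elim (hπ i j hs.1) (hσ i j hs.1)
    refine weakPerm_le_iff.2 fun i j hij h1 => ?_
    have h2 := (h i j hij).1 h1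
    clear h1 hij
    induction h2 with
    | single hs => exact step _ _ hs
    | tail _ hs ih => exact ih.trans (step _ _ hs)

/-- Since `indexing c` is an involution, it carries the permutation built from positions back to
either convention. -/
theorem exists_isGLB_joinNoninv {c : InversionKind} (π σ : WeakPerm c m) :
    ∃ μ : WeakPerm c m, IsGLB {π, σ} μ ∧ ∀ i j : Fin m, i < j →
      (indexing c μ i < indexing c μ j ↔ JoinNoninv (indexing c π) (indexing c σ) i j) := by
  obtain ⟨ρ, hρ⟩ := exists_perm_joinNoninv (indexing c π) (indexing c σ)
  have : ∀ i j : Fin m, i < j → (indexing c (indexing c ρ) i < indexing c (indexing c ρ) j ↔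
      JoinNoninv (indexing c π) (indexing c σ) i j) := by
    rwa [indexing_indexing]
  exact ⟨indexing c ρ, isGLB_of_joinNoninv this, this⟩

/-! ### The image of `phi` and its closure under meets -/

/-- The entries of the word of `π` following the largest letter are in descending order. -/
def DescendingAfterLast (π : Equiv.Perm (Fin (n + 1))) : Prop :=
  ∀ i j, π.symm (Fin.last n) < i → i < j → π j < π i

theorem descendingAfterLast_phi (w : PartialPerm n) : DescendingAfterLast (phi w) := by
  have hget : ∀ (i : Fin (n + 1)) (h : (i : ℕ) < (extWord w).length),
      phi w i = (extWord w)[(i : ℕ)] := fun i h => by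
    simp only [← ofFn_phi, List.getElem_ofFn]
  have hlen : ∀ i : Fin (n + 1), (i : ℕ) < (extWord w).length := fun i => by
    rw [extWord_length]; exact i.2
  set D := (List.finRange (n + 1)).reverse.filter (fun a => a ∉ w.1.map Fin.castSucc) with hD
  have hpw : D.Pairwise (· > ·) :=
    (List.pairwise_reverse.2 (List.pairwise_lt_finRange (n + 1))).filter _
  intro i j hi hij
  -- The entries of `w` are never the largest letter, so that letter lies in the descending tail
  -- `D`.
  have hk : w.1.length ≤ ((phi w).symm (Fin.last n) : ℕ) := by
    by_contra! hlt
    have h1 := hget _ (hlen ((phi w).symm (Fin.last n)))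
    have h2 : (phi w) ((phi w).symm (Fin.last n)) = Fin.last n := (phi w).apply_symm_apply _
    rw [h2] at h1
    have h3 : (extWord w)[((phi w).symm (Fin.last n) : ℕ)]'(hlen _) =
        (w.1.map Fin.castSucc)[((phi w).symm (Fin.last n) : ℕ)]'(by simpa using hlt) :=
      List.getElem_append_left _
    rw [h3, List.getElem_map] at h1
    exact Fin.castSucc_ne_last _ h1.symm
  have hk' : ∀ i : Fin (n + 1), (phi w).symm (Fin.last n) < i → w.1.length ≤ (i : ℕ) :=
    fun i hi => hk.trans (le_of_lt hi)
  have hlD : (extWord w).length = w.1.length + D.length := by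
    simp [extWord, hD]
  have hgetD : ∀ (i : Fin (n + 1)) (h : w.1.length ≤ (i : ℕ)), phi w i =
      D[(i : ℕ) - w.1.length]'(by have := hlen i; omega) := fun i h => by
    rw [hget i (hlen i)]
    have h1 : (w.1.map Fin.castSucc).length ≤ (i : ℕ) := by rwa [List.length_map]
    refine (List.getElem_append_right (bs := D) (h₂ := hlen i) h1).trans ?_
    simp only [List.length_map]
  rw [hgetD i (hk' i hi), hgetD j (hk' j (hi.trans hij))]
  refine List.pairwise_iff_getElem.1 hpw _ _ _ _ ?_
  have := hk' i hi
  have : (i : ℕ) < j := hij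
  omega

theorem exists_phi_eq {π : Equiv.Perm (Fin (n + 1))} (h : DescendingAfterLast π) :
    ∃ w : PartialPerm n, phi w = π := by
  set k : Fin (n + 1) := π.symm (Fin.last n) with hk
  have hπk : π k = Fin.last n := π.apply_symm_apply _
  set L := List.ofFn π with hL
  have hLnd : L.Nodup := List.nodup_ofFn.2 π.injective
  have hsplit : L.take k ++ L.drop k = L := List.take_append_drop _ _
  have hlast : Fin.last n ∉ L.take k := by
    intro hmem
    obtain ⟨i, hi, hi'⟩ := List.mem_iff_getElem.1 hmem
    simp only [List.length_take, lt_min_iff] at hi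
    simp only [List.getElem_take, hL, List.getElem_ofFn] at hi'
    rw [← hπk] at hi'
    have := congrArg Fin.val (π.injective hi')
    simp at this
    omega
  obtain ⟨l, hl⟩ : ∃ l : List (Fin n), l.map Fin.castSucc = L.take k := by
    have : L.take k ∈ Set.range (List.map (Fin.castSucc (n := n))) := by
      rw [Set.range_list_map]
      intro a ha
      exact ⟨a.castPred fun h' => hlast (h' ▸ ha), by simp⟩
    exact this
  have hlnd : l.Nodup := List.Nodup.of_map _ (hl ▸ hLnd.sublist (List.take_sublist _ _))
  refine ⟨⟨l, hlnd⟩, ?_⟩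
  have hdrop : (L.drop k).Pairwise (· > ·) := by
    rw [List.pairwise_iff_getElem]
    intro i j hi hj hij
    simp only [List.length_drop] at hi hj
    simp only [List.getElem_drop, hL, List.getElem_ofFn, gt_iff_lt]
    -- Entry `0` of the tail is the largest letter itself, about which `h` says nothing.
    rcases Nat.eq_zero_or_pos i with rfl | hpos
    · have h1 : (⟨k + 0, by omega⟩ : Fin (n + 1)) = k := by simp
      rw [h1, hπk]
      refine lt_of_le_of_ne (Fin.le_last _) fun h2 => ?_
      rw [← hπk] at h2
      have := congrArg Fin.val (π.injective h2)
      simp at this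
      omega
    · refine h _ _ ?_ ?_
      · rw [← hk, Fin.lt_def]; simp; omega
      · rw [Fin.lt_def]; simp; omega
  have hext : extWord (⟨l, hlnd⟩ : PartialPerm n) = L := by
    rw [← hsplit]
    unfold extWord
    rw [hl]
    congr 1
    have hpw : ((List.finRange (n + 1)).reverse.filter (fun a => a ∉ L.take k)).Pairwise (· > ·) :=
      (List.pairwise_reverse.2 (List.pairwise_lt_finRange (n + 1))).filter _
    refine List.Perm.eq_of_pairwise (fun a b _ _ h1 h2 => absurd h1 (lt_asymm h2)) hpw hdrop
      ((List.perm_ext_iff_of_nodup (hpw.imp ne_of_gt) (hdrop.imp ne_of_gt)).2 fun a => ?_)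
    have hmem : a ∈ L.take k ∨ a ∈ L.drop k := by
      rw [← List.mem_append, hsplit, hL, List.mem_ofFn]
      exact π.surjective a
    have hdisj : a ∈ L.take k → a ∉ L.drop k := fun h1 h2 =>
      List.disjoint_of_nodup_append (hsplit.symm ▸ hLnd) h1 h2
    simp only [List.mem_filter, List.mem_reverse, List.mem_finRange, true_and, decide_eq_true_eq]
    tauto
  apply Equiv.ext
  intro i
  have := (ofFn_phi (⟨l, hlnd⟩ : PartialPerm n)).trans hext
  exact congrFun (List.ofFn_injective this) i

/-- The permutations that descend after the largest letter are closed under meets. -/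
theorem DescendingAfterLast.of_joinNoninv {c : InversionKind} {π σ μ : Equiv.Perm (Fin (n + 1))}
    (hπ : DescendingAfterLast π) (hσ : DescendingAfterLast σ)
    (h : ∀ i j : Fin (n + 1), i < j →
      (indexing c μ i < indexing c μ j ↔ JoinNoninv (indexing c π) (indexing c σ) i j)) :
    DescendingAfterLast μ := by
  cases c with
  | positions =>
    change ∀ i j : Fin (n + 1), i < j → (μ i < μ j ↔ JoinNoninv π σ i j) at h
    have weak : ∀ {τ : Equiv.Perm (Fin (n + 1))}, DescendingAfterLast τ → ∀ i j,
        τ.symm (Fin.last n) ≤ i → i < j → τ j < τ i := by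
      intro τ hτ i j hi hij
      rcases hi.eq_or_lt with rfl | hi
      · rw [Equiv.apply_symm_apply]
        refine lt_of_le_of_ne (Fin.le_last _) fun h1 => ?_
        rw [← h1, Equiv.symm_apply_apply] at hij
        exact hij.ne rfl
      · exact hτ i j hi hij
    -- From position `k` on, both words descend, so no generating noninversion starts there.
    set k := max (π.symm (Fin.last n)) (σ.symm (Fin.last n)) with hk
    have hno : ∀ i j, k ≤ i → ¬ JoinNoninv π σ i j := by
      intro i j hi hN
      induction hN using Relation.TransGen.head_induction_on with
      | single hs =>
        exact hs.2.elim (weak hπ _ _ ((le_max_left _ _).trans hi) hs.1).asymm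
          (weak hσ _ _ ((le_max_right _ _).trans hi) hs.1).asymm
      | head hs _ ih => exact ih (hi.trans hs.1.le)
    have hdesc : ∀ i j, k ≤ i → i < j → μ j < μ i := fun i j hi hij =>
      lt_of_le_of_ne (not_lt.1 fun h1 => hno i j hi ((h i j hij).1 h1))
        fun h1 => hij.ne' (μ.injective h1)
    -- One of the two words has its largest letter at `k`; an earlier position of it in `μ` would
    -- form a noninversion with `k`.
    have hkmax : k ≤ μ.symm (Fin.last n) := by
      by_contra! hlt
      have hlast : ∀ τ : Equiv.Perm (Fin (n + 1)), τ.symm (Fin.last n) = k →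
          τ (μ.symm (Fin.last n)) < τ k := fun τ hτ => by
        have hne : τ (μ.symm (Fin.last n)) ≠ τ k := fun h1 => hlt.ne (τ.injective h1)
        rw [← hτ, Equiv.apply_symm_apply] at hne ⊢
        exact lt_of_le_of_ne (Fin.le_last _) hne
      have h1 : μ (μ.symm (Fin.last n)) < μ k := (h _ _ hlt).2 (.single ⟨hlt, by
        rcases max_choice (π.symm (Fin.last n)) (σ.symm (Fin.last n)) with h1 | h1
        · exact Or.inl (hlast π (h1.symm.trans hk.symm))
        · exact Or.inr (hlast σ (h1.symm.trans hk.symm))⟩)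
      rw [Equiv.apply_symm_apply] at h1
      exact absurd h1 (not_lt.2 (Fin.le_last _))
    exact fun i j hi hij => hdesc i j (hkmax.trans hi.le) hij
  | values =>
    change ∀ i j : Fin (n + 1), i < j →
      (μ.symm i < μ.symm j ↔ JoinNoninv π.symm σ.symm i j) at h
    have byValues : ∀ {τ : Equiv.Perm (Fin (n + 1))}, DescendingAfterLast τ → ∀ a b,
        a < b → τ.symm a < τ.symm b → ¬ τ.symm (Fin.last n) < τ.symm a := by
      intro τ hτ a b hab h1 h2
      have := hτ _ _ h2 h1
      simp only [Equiv.apply_symm_apply] at this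
      exact hab.asymm this
    intro i j hi hij
    by_contra! hle
    have hlt : μ i < μ j := lt_of_le_of_ne hle fun h1 => hij.ne (μ.injective h1)
    have hN : JoinNoninv π.symm σ.symm (μ i) (μ j) := (h _ _ hlt).1 (by simpa using hij)
    -- Only the first link of the chain matters: in the word providing it, `μ i` has a larger letter
    -- after it, so it cannot follow the largest letter. Then `μ i` and the largest letter form a
    -- noninversion, which `μ` inherits.
    obtain ⟨b, hs⟩ : ∃ b, (μ i < b ∧ (π.symm (μ i) < π.symm b ∨ σ.symm (μ i) < σ.symm b)) := by
      cases hN using Relation.TransGen.head_induction_on with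
      | single hs => exact ⟨_, hs⟩
      | head hs _ => exact ⟨_, hs⟩
    have hil : μ i < Fin.last n := hs.1.trans_le (Fin.le_last _)
    have hnot : ¬ JoinNoninv π.symm σ.symm (μ i) (Fin.last n) := fun h1 => by
      have := (h _ _ hil).2 h1
      rw [Equiv.symm_apply_apply] at this
      exact this.asymm hi
    have hle' : ∀ τ : Equiv.Perm (Fin (n + 1)), ¬ τ.symm (μ i) < τ.symm (Fin.last n) →
        τ.symm (Fin.last n) < τ.symm (μ i) := fun τ h1 =>
      lt_of_le_of_ne (not_lt.1 h1) fun h2 => hil.ne' (τ.symm.injective h2)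
    rcases hs.2 with h1 | h1
    · exact byValues hπ _ _ hs.1 h1 (hle' π fun h2 => hnot (.single ⟨hil, Or.inl h2⟩))
    · exact byValues hσ _ _ hs.1 h1 (hle' σ fun h2 => hnot (.single ⟨hil, Or.inr h2⟩))

/-- The map `phi`, as an order embedding. -/
def phiEmbedding (c : InversionKind) (n : ℕ) : WeakPartialPerm c n ↪o WeakPerm c (n + 1) where
  toFun w := phi w
  inj' := phi_injective n
  map_rel_iff' := Iff.rfl

theorem exists_isTop_phiEmbedding (c : InversionKind) (n : ℕ) :
    ∃ t, IsTop (phiEmbedding c n t) := by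
  have hdesc : DescendingAfterLast (Fin.revPerm : Equiv.Perm (Fin (n + 1))) :=
    fun i j _ hij => Fin.rev_lt_rev.2 hij
  obtain ⟨t, ht⟩ := exists_phi_eq hdesc
  refine ⟨t, fun σ => weakPerm_le_iff.2 fun i j hij h => absurd h ?_⟩
  change ¬ indexing c (phi t) i < indexing c (phi t) j
  rw [ht]
  cases c <;> exact (Fin.rev_lt_rev.2 hij).asymm

end Weak

end PartialWeak

theorem theorem7p4 (c : PartialWeak.InversionKind) (n : ℕ) :
    -- any two partial permutations have a join and a meet in the partial weak Bruhat order
    (∀ π σ : PartialWeak.WeakPartialPerm c n,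
      (∃ τ, IsLUB {π, σ} τ) ∧ (∃ τ, IsGLB {π, σ} τ)) ∧
    -- there is a surjective map from the weak Bruhat order preserving joins (which exist)
    (∃ f : PartialWeak.WeakPerm c (n + 1) → PartialWeak.WeakPartialPerm c n,
      Function.Surjective f ∧
      ∀ u v : PartialWeak.WeakPerm c (n + 1),
        ∃ w, IsLUB {u, v} w ∧ IsLUB {f u, f v} (f w)) := by
  have : Finite (PartialWeak.WeakPerm c (n + 1)) :=
    inferInstanceAs (Finite (Equiv.Perm (Fin (n + 1))))
  have : Finite (PartialWeak.WeakPartialPerm c n) :=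
    Finite.of_injective _ (PartialWeak.phiEmbedding c n).injective
  obtain ⟨t, ht⟩ := PartialWeak.exists_isTop_phiEmbedding c n
  refine PartialWeak.join_quotient_of_inf_closed (PartialWeak.phiEmbedding c n)
    (fun u v => (PartialWeak.exists_isGLB_joinNoninv u v).imp fun _ h => h.1) t ht
    fun x y w hw => ?_
  obtain ⟨μ, hμ, hμN⟩ := PartialWeak.exists_isGLB_joinNoninv
    (PartialWeak.phiEmbedding c n x) (PartialWeak.phiEmbedding c n y)
  obtain rfl := hw.unique hμ
  exact PartialWeak.exists_phi_eq ((PartialWeak.descendingAfterLast_phi x).of_joinNoninv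
    (PartialWeak.descendingAfterLast_phi y) hμN)
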